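/- For an integer $r\ge 1$, a unit vector $|\psi\rangle\in\mathbb{C}^{d_1}\otimes\cdots\otimes\mathbb{C}^{d_n}$ is called an $r$-uniform state if, for every $r$-element subset $S\subseteq\{1,\dots,n\}$ of the parties, the partial trace of $|\psi\rangle\langle\psi|$ over all parties outside $S$ equals $\frac{1}{\prod_{i\in S}d_i}\,I_S$, where $I_S$ is the identity operator on $\bigotimes_{i\in S}\mathbb{C}^{d_i}$. Then $2$-uniform states exist in each of the following spaces: * $\mathbb{C}^3\otimes(\mathbb{C}^2)^{\otimes N}$ for every integer $N\ge 8$; * $(\mathbb{C}^3)^{\otimes 2}\otimes(\mathbb{C}^2)^{\otimes N}$ for every integer $N\ge 12$; * $(\mathbb{C}^3)^{\otimes 3}\otimes(\mathbb{C}^2)^{\otimes N}$ for $N=8$ and for every integer $N\ge 10$, and $(\mathbb{C}^3)^{\otimes 4}\otimes(\mathbb{C}^2)^{\otimes N}$ for every integer $N\ge 4$. -/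

import Mathlib

namespace QuantumUniform

/-- The computational basis labels of a multipartite system with parties `ι` and local dimensions
`d i`: one basis label in `Fin (d i)` for every party `i`. -/
abbrev Labels {ι : Type*} (d : ι → ℕ) : Type _ := (i : ι) → Fin (d i)

/-- The Hilbert space `⨂ i, ℂ^(d i)`, written in its computational product basis: a vector is the
family of its coefficients in the basis `⨂ i, |x i⟩`, with the standard Hermitian inner product. -/
abbrev TensorSpace {ι : Type*} (d : ι → ℕ) : Type _ := EuclideanSpace ℂ (Labels d)

/-- The joint label that agrees with `x` on the parties in `S` and with `z` on the others. -/
def joinLabels {ι : Type*} [DecidableEq ι] {d : ι → ℕ} (S : Finset ι)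
    (x : (i : {i // i ∈ S}) → Fin (d i)) (z : (i : {i // i ∉ S}) → Fin (d i)) : Labels d :=
  fun i => if h : i ∈ S then x ⟨i, h⟩ else z ⟨i, h⟩

/-- The partial trace of an operator over all parties outside `S`. -/
def partialTraceCompl {ι : Type*} [Fintype ι] [DecidableEq ι] {d : ι → ℕ} (S : Finset ι)
    (ρ : Matrix (Labels d) (Labels d) ℂ) :
    Matrix ((i : {i // i ∈ S}) → Fin (d i)) ((i : {i // i ∈ S}) → Fin (d i)) ℂ :=
  Matrix.of fun x y => ∑ z : (i : {i // i ∉ S}) → Fin (d i),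
    ρ (joinLabels S x z) (joinLabels S y z)

/-- The operator `|ψ⟩⟨ψ|`. -/
def dyad {ι : Type*} {d : ι → ℕ} (ψ : TensorSpace d) : Matrix (Labels d) (Labels d) ℂ :=
  Matrix.of fun x y => ψ x * star (ψ y)

/-- A state (unit vector) `ψ` is `r`-uniform if its reduction to any `r` parties is maximally
mixed, that is, equal to the identity divided by the product of the `r` local dimensions. -/
def IsUniformState {ι : Type*} [Fintype ι] [DecidableEq ι] {d : ι → ℕ} (r : ℕ)
    (ψ : TensorSpace d) : Prop :=
  ‖ψ‖ = 1 ∧ ∀ S : Finset ι, S.card = r →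
    partialTraceCompl S (dyad ψ) = (1 / ((∏ i ∈ S, d i : ℕ) : ℂ)) • 1

/-- The local dimensions of `(ℂ^3)^{⊗a} ⊗ (ℂ^2)^{⊗N}`: first `a` qutrits, then `N` qubits. -/
def qutritsQubits (a N : ℕ) : Fin a ⊕ Fin N → ℕ :=
  Sum.elim (fun _ => 3) (fun _ => 2)

end QuantumUniform

/-!
The states are superpositions of computational basis vectors with amplitudes `0` and `±1`, up to
normalization. The reduction of such a state to a set `S` of parties is maximally mixed when
permutations of the labels witness it (`isUniformState_of_perm`): label permutations that translate
the `S`-coordinates and keep the moduli of the amplitudes make the diagonal entries equal, and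
label permutations that fix the `S`-coordinates and reverse the sign of a product of two amplitudes
make the off-diagonal entries cancel.

With one exception, one construction serves (`exists_isUniformState_ring`). Take a ternary linear
code `C` of strength two on the qutrits, attach to `y ∈ C` a bit string `k y`, and superpose
`|y⟩ ⊗ Z^(k y) |ring⟩` over `y ∈ C`, where `|ring⟩` is the graph state of the cycle on the qubits.
For two labels that differ only in `S`, flipping the qubit `m ∉ S` in both reverses the sign of the
product of their amplitudes if and only if the number of neighbours of `m` at which the labels
differ, plus one if `k` changes at `m`, is odd. When the two labels have the
same `y`, the flip exists because vertices of a cycle of length at least five have distinct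
neighbourhoods even after removal of two vertices (`exists_neighbor_sum_eq_one`). When they have
different `y`, it exists because at most one qubit of `S` differs, and this qubit and its two
neighbours cannot exhaust four places at which `k` changes. For one, two or three qutrits and at
least eight qubits, the strings `k y` are words of the extended Hamming code `[8, 4, 4]`. For four
qutrits, `C` is the tetracode of distance three, two labels with different `y` are never compared,
and `k = 0` will do for every `N ≥ 5`.

The exception is four qutrits and four qubits, since four qubits have no 2-uniform state. There the
state is the equal superposition of 72 labels: the four pairs of complementary bit strings of even
weight, each joined with its own coset of the tetracode.
-/

namespace QuantumUniform

/-! ### A symmetry criterion for uniformity -/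

section Criterion

variable {ι : Type*} [Fintype ι] [DecidableEq ι] {d : ι → ℕ}

/-- The sum over the labels of the discarded parties that computes an entry of a partial trace is
a sum over the full labels `w` whose restriction to `S` is the row index. -/
theorem sum_joinLabels {M : Type*} [AddCommMonoid M] (S : Finset ι)
    (x : (i : {i // i ∈ S}) → Fin (d i)) (f : Labels d → M) :
    ∑ z : (i : {i // i ∉ S}) → Fin (d i), f (joinLabels S x z) =
      ∑ w : Labels d with S.restrict w = x, f w := by
  refine Finset.sum_nbij' (fun z => joinLabels S x z) (fun w i => w i) ?_ ?_ ?_ ?_ ?_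
  · intro z _
    simp only [Finset.mem_filter, Finset.mem_univ, true_and]
    funext i
    simp [joinLabels]
  · simp
  · intro z _
    funext i
    simp [joinLabels, i.2]
  · intro w hw
    simp only [Finset.mem_filter, Finset.mem_univ, true_and] at hw
    subst hw
    funext i
    simp [joinLabels]
  · simp

/-- A unit vector is `r`-uniform as soon as each set `S` of `r` parties admits two kinds of
permutations of the labels: those that translate the `S`-coordinates arbitrarily and preserve the
modulus of the amplitudes, which make the diagonal entries of the reduction equal, and those that
fix the `S`-coordinates and reverse the sign of `ψ w * star (ψ (w + δ))`, which make the
off-diagonal entries in position `δ` cancel. -/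
theorem isUniformState_of_perm [∀ i, NeZero (d i)] {r : ℕ} (ψ : TensorSpace d) (hψ : ‖ψ‖ = 1)
    (hdiag : ∀ S : Finset ι, S.card = r → ∀ u : Labels d, ∃ τ : Equiv.Perm (Labels d),
      ∀ w, ‖ψ (τ w)‖ = ‖ψ w‖ ∧ ∀ i ∈ S, τ w i = w i + u i)
    (hoff : ∀ S : Finset ι, S.card = r → ∀ δ : Labels d, (∀ i ∉ S, δ i = 0) → δ ≠ 0 →
      ∃ τ : Equiv.Perm (Labels d), ∀ w, (∀ i ∈ S, τ w i = w i) ∧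
        ψ (τ w) * star (ψ (τ w + δ)) = -(ψ w * star (ψ (w + δ)))) :
    IsUniformState r ψ := by
  refine ⟨hψ, fun S hS => ?_⟩
  ext x y
  let δ : Labels d := fun i => if h : i ∈ S then y ⟨i, h⟩ - x ⟨i, h⟩ else 0
  have hjoin : ∀ z, joinLabels S y z = joinLabels S x z + δ := by
    intro z
    funext i
    by_cases h : i ∈ S <;> simp [joinLabels, δ, h]
  have hsum : partialTraceCompl S (dyad ψ) x y =
      ∑ w : Labels d with S.restrict w = x, ψ w * star (ψ (w + δ)) := by
    rw [← sum_joinLabels]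
    simp only [partialTraceCompl, dyad, Matrix.of_apply, hjoin]
  rw [hsum]
  by_cases hxy : x = y
  · subst hxy
    have hδ : δ = 0 := by
      funext i
      simp [δ]
    let T : ((i : {i // i ∈ S}) → Fin (d i)) → ℝ := fun x =>
      ∑ w : Labels d with S.restrict w = x, ‖ψ w‖ ^ 2
    have hT : ∀ x', T x' = T x := by
      intro x'
      obtain ⟨τ, hτ⟩ := hdiag S hS (fun i => if h : i ∈ S then x' ⟨i, h⟩ - x ⟨i, h⟩ else 0)
      symm
      refine Finset.sum_equiv τ (fun w => ?_) (fun w _ => by rw [(hτ w).1])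
      simp only [Finset.mem_filter, Finset.mem_univ, true_and, funext_iff, Finset.restrict]
      refine forall_congr' fun i => ?_
      rw [(hτ w).2 i i.2]
      simp only [i.2, dite_true]
      constructor
      · intro h
        rw [h]
        abel
      · intro h
        rw [eq_sub_of_add_eq h]
        abel
    have htot : ∑ x', T x' = 1 := by
      have h1 : ∑ w : Labels d, ‖ψ w‖ ^ 2 = 1 := by
        rw [← EuclideanSpace.norm_sq_eq, hψ, one_pow]
      rw [← h1]
      exact Finset.sum_fiberwise _ _ _
    have hcard : (∏ i ∈ S, d i : ℕ) * T x = 1 := by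
      rw [← htot, Finset.sum_congr rfl (fun x' _ => hT x'), Finset.sum_const, Finset.card_univ,
        nsmul_eq_mul, Fintype.card_pi]
      simp only [Fintype.card_fin]
      rw [Finset.prod_coe_sort S d]
    have hTx : ∑ w : Labels d with S.restrict w = x, ψ w * star (ψ (w + δ)) = (T x : ℂ) := by
      simp only [T, hδ, add_zero, Complex.ofReal_sum]
      refine Finset.sum_congr rfl fun w _ => ?_
      have := Complex.mul_conj' (ψ w)
      simpa using this
    rw [hTx, Matrix.smul_apply, Matrix.one_apply_eq, smul_eq_mul, mul_one]
    have hc : ((∏ i ∈ S, d i : ℕ) : ℂ) * (T x : ℂ) = 1 := by exact_mod_cast hcard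
    exact eq_one_div_of_mul_eq_one_right hc
  · have hδ : δ ≠ 0 := by
      intro h
      apply hxy
      funext i
      have := congrFun h i
      simp only [δ, i.2, dite_true, Pi.zero_apply] at this
      exact (sub_eq_zero.1 this).symm
    obtain ⟨τ, hτ⟩ := hoff S hS δ (fun i hi => by simp [δ, hi]) hδ
    have hneg : ∑ w : Labels d with S.restrict w = x, ψ w * star (ψ (w + δ)) =
        -∑ w : Labels d with S.restrict w = x, ψ w * star (ψ (w + δ)) := by
      rw [← Finset.sum_neg_distrib]
      symm
      refine Finset.sum_equiv τ (fun w => ?_) (fun w _ => (hτ w).2.symm)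
      simp only [Finset.mem_filter, Finset.mem_univ, true_and, funext_iff, Finset.restrict]
      refine forall_congr' fun i => ?_
      rw [(hτ w).1 i i.2]
    rw [self_eq_neg.1 hneg, Matrix.smul_apply, Matrix.one_apply_ne hxy, smul_zero]

/-- Normalized form of `isUniformState_of_perm` for integer amplitudes. -/
theorem exists_isUniformState_of_perm [∀ i, NeZero (d i)] {r : ℕ} (φ : Labels d → ℤ)
    (hφ : ∃ w, φ w ≠ 0)
    (hdiag : ∀ S : Finset ι, S.card = r → ∀ u : Labels d, ∃ τ : Equiv.Perm (Labels d),
      ∀ w, φ (τ w) ^ 2 = φ w ^ 2 ∧ ∀ i ∈ S, τ w i = w i + u i)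
    (hoff : ∀ S : Finset ι, S.card = r → ∀ δ : Labels d, (∀ i ∉ S, δ i = 0) → δ ≠ 0 →
      ∃ τ : Equiv.Perm (Labels d), ∀ w, (∀ i ∈ S, τ w i = w i) ∧
        φ (τ w) * φ (τ w + δ) = -(φ w * φ (w + δ))) :
    ∃ ψ : TensorSpace d, IsUniformState r ψ := by
  let v : TensorSpace d := WithLp.toLp 2 fun w => (φ w : ℂ)
  have hv : v ≠ 0 := by
    obtain ⟨w, hw⟩ := hφ
    intro h
    have : v w = 0 := by rw [h]; rfl
    exact hw (by simpa [v] using this)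
  refine ⟨((‖v‖⁻¹ : ℝ) : ℂ) • v, isUniformState_of_perm _ ?_ ?_ ?_⟩
  · rw [norm_smul, Complex.norm_real, norm_inv, norm_norm, inv_mul_cancel₀ (norm_ne_zero_iff.2 hv)]
  · intro S hS u
    obtain ⟨τ, hτ⟩ := hdiag S hS u
    refine ⟨τ, fun w => ⟨?_, (hτ w).2⟩⟩
    have h : |φ (τ w)| = |φ w| := sq_eq_sq_iff_abs_eq_abs _ _ |>.1 (hτ w).1
    have h' : |(φ (τ w) : ℝ)| = |(φ w : ℝ)| := by exact_mod_cast h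
    simp [v, Complex.norm_intCast, h']
  · intro S hS δ hδ hδ0
    obtain ⟨τ, hτ⟩ := hoff S hS δ hδ hδ0
    refine ⟨τ, fun w => ⟨(hτ w).1, ?_⟩⟩
    have h : (φ (τ w) : ℂ) * φ (τ w + δ) = -(φ w * φ (w + δ)) := by exact_mod_cast (hτ w).2
    simp only [v, PiLp.smul_apply, smul_eq_mul, star_mul', Complex.star_def, Complex.conj_ofReal,
      map_intCast]
    linear_combination (((‖v‖⁻¹ : ℝ) : ℂ) ^ 2) * h

end Criterion

instance (a N : ℕ) (i : Fin a ⊕ Fin N) : NeZero (qutritsQubits a N i) :=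
  match i with
  | .inl _ => ⟨three_ne_zero⟩
  | .inr _ => ⟨two_ne_zero⟩

/-- The labels of `(ℂ^3)^{⊗a} ⊗ (ℂ^2)^{⊗N}` as pairs of a vector over `ZMod 3` and a vector over
`ZMod 2`. -/
def labelsEquiv (a N : ℕ) :
    Labels (qutritsQubits a N) ≃ (Fin a → ZMod 3) × (Fin N → ZMod 2) where
  toFun w := (fun i => w (.inl i), fun j => w (.inr j))
  invFun v := fun
    | .inl i => v.1 i
    | .inr j => v.2 j
  left_inv w := by
    funext i
    cases i <;> rfl
  right_inv _ := rfl

theorem labelsEquiv_add (a N : ℕ) (w w' : Labels (qutritsQubits a N)) :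
    labelsEquiv a N (w + w') = labelsEquiv a N w + labelsEquiv a N w' := rfl

/-- `exists_isUniformState_of_perm` for pairs of parties in `(ℂ^3)^{⊗a} ⊗ (ℂ^2)^{⊗N}`; the pair
consists of the qutrits in `P` and the qubits in `Q`. -/
theorem exists_isUniformState_two_of_perm {a N : ℕ}
    (φ : (Fin a → ZMod 3) × (Fin N → ZMod 2) → ℤ) (hφ : ∃ w, φ w ≠ 0)
    (hdiag : ∀ (P : Finset (Fin a)) (Q : Finset (Fin N)), P.card + Q.card = 2 →
      ∀ u : (Fin a → ZMod 3) × (Fin N → ZMod 2),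
      ∃ τ : Equiv.Perm ((Fin a → ZMod 3) × (Fin N → ZMod 2)), ∀ w, φ (τ w) ^ 2 = φ w ^ 2 ∧
        (∀ i ∈ P, (τ w).1 i = w.1 i + u.1 i) ∧ ∀ j ∈ Q, (τ w).2 j = w.2 j + u.2 j)
    (hoff : ∀ (P : Finset (Fin a)) (Q : Finset (Fin N)), P.card + Q.card = 2 →
      ∀ δ : (Fin a → ZMod 3) × (Fin N → ZMod 2),
      (∀ i ∉ P, δ.1 i = 0) → (∀ j ∉ Q, δ.2 j = 0) → δ ≠ 0 →
      ∃ τ : Equiv.Perm ((Fin a → ZMod 3) × (Fin N → ZMod 2)), ∀ w,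
        (∀ i ∈ P, (τ w).1 i = w.1 i) ∧ (∀ j ∈ Q, (τ w).2 j = w.2 j) ∧
        φ (τ w) * φ (τ w + δ) = -(φ w * φ (w + δ))) :
    ∃ ψ : TensorSpace (qutritsQubits a N), IsUniformState 2 ψ := by
  let e := labelsEquiv a N
  refine exists_isUniformState_of_perm (fun w => φ (e w)) ?_ ?_ ?_
  · obtain ⟨w, hw⟩ := hφ
    exact ⟨e.symm w, by simpa using hw⟩
  · intro S hS u
    obtain ⟨τ, hτ⟩ := hdiag S.toLeft S.toRight (by rw [S.card_toLeft_add_card_toRight, hS]) (e u)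
    refine ⟨(e.trans τ).trans e.symm, fun w => ⟨by simpa using (hτ (e w)).1, ?_⟩⟩
    rintro (i | j) hi
    · exact (hτ (e w)).2.1 i (Finset.mem_toLeft.2 hi)
    · exact (hτ (e w)).2.2 j (Finset.mem_toRight.2 hi)
  · intro S hS δ hδ hδ0
    obtain ⟨τ, hτ⟩ := hoff S.toLeft S.toRight (by rw [S.card_toLeft_add_card_toRight, hS]) (e δ)
      (fun i hi => hδ (.inl i) (fun h => hi (Finset.mem_toLeft.2 h)))
      (fun j hj => hδ (.inr j) (fun h => hj (Finset.mem_toRight.2 h)))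
      (fun h => hδ0 (e.injective h))
    refine ⟨(e.trans τ).trans e.symm, fun w => ⟨?_, ?_⟩⟩
    · rintro (i | j) hi
      · exact (hτ (e w)).1 i (Finset.mem_toLeft.2 hi)
      · exact (hτ (e w)).2.1 j (Finset.mem_toRight.2 hi)
    · have h := (hτ (e w)).2.2
      simpa [e, labelsEquiv_add] using h

/-! ### Ring graph states with a controlled family of sign patterns -/

/-- The sign `(-1)^b` of a bit. -/
def bitSign (b : ZMod 2) : ℤ := if b = 0 then 1 else -1

theorem bitSign_add (b c : ZMod 2) : bitSign (b + c) = bitSign b * bitSign c := by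
  revert b c
  decide

theorem bitSign_sq (b : ZMod 2) : bitSign b ^ 2 = 1 := by
  revert b
  decide

section Ring

variable {κ : Type*} [DecidableEq κ]

/-- In a union of cycles of length at least five, no two vertices have the same neighbours outside
the two of them, and no vertex has all its neighbours among two vertices: a nonzero `ε` supported
on at most two vertices has a vertex outside this set at which its neighbour sum is odd. -/
theorem exists_neighbor_sum_eq_one {σ : Equiv.Perm κ} (h1 : ∀ i, σ i ≠ i) (h2 : ∀ i, σ (σ i) ≠ i)
    (h3 : ∀ i, σ (σ (σ i)) ≠ i) (h4 : ∀ i, σ (σ (σ (σ i))) ≠ i) {Q : Finset κ} (hQ : Q.card ≤ 2)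
    {ε : κ → ZMod 2} (hε : ∀ j ∉ Q, ε j = 0) (hε0 : ε ≠ 0) :
    ∃ m ∉ Q, ε (σ m) + ε (σ.symm m) = 1 := by
  obtain ⟨i, hi⟩ := Function.ne_iff.1 hε0
  have hiQ : i ∈ Q := by
    by_contra h
    exact hi (hε i h)
  have hi1 : ε i = 1 := by
    have : ∀ b : ZMod 2, b ≠ 0 → b = 1 := by decide
    exact this _ hi
  obtain ⟨j, hj⟩ : ∃ j, ∀ m, m ≠ i → m ≠ j → m ∉ Q := by
    have hc : (Q.erase i).card ≤ 1 := by
      rw [Finset.card_erase_of_mem hiQ]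
      omega
    have : Nonempty κ := ⟨i⟩
    obtain ⟨j, hj⟩ := Finset.card_le_one_iff_subset_singleton.1 hc
    refine ⟨j, fun m hmi hmj hm => hmj ?_⟩
    simpa using hj (Finset.mem_erase.2 ⟨hmi, hm⟩)
  by_cases hc : j = σ i ∨ j = σ (σ i)
  · obtain ⟨k, rfl⟩ : ∃ k, σ (σ k) = i := ⟨σ.symm (σ.symm i), by simp⟩
    refine ⟨σ k, hj _ (h1 _).symm ?_, ?_⟩
    · rcases hc with rfl | rfl
      exacts [(h2 _).symm, (h3 _).symm]
    · rw [Equiv.symm_apply_apply, hi1, hε k (hj _ (h2 _).symm ?_), add_zero]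
      rcases hc with rfl | rfl
      exacts [(h3 _).symm, (h4 _).symm]
  · push Not at hc
    refine ⟨σ i, hj _ (h1 _) hc.1.symm, ?_⟩
    rw [Equiv.symm_apply_apply, hi1, hε _ (hj _ (h2 _) hc.2.symm), zero_add]

variable [Fintype κ]

/-- The quadratic form `∑ i, x i * x (σ i)` over `ZMod 2`, whose signs are the amplitudes of the
graph state of the union of the cycles of `σ`. -/
def cycleForm (σ : Equiv.Perm κ) (x : κ → ZMod 2) : ZMod 2 := ∑ i, x i * x (σ i)

theorem cycleForm_add_single {σ : Equiv.Perm κ} {m : κ} (hm : σ m ≠ m) (x : κ → ZMod 2) :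
    cycleForm σ (x + Pi.single m 1) = cycleForm σ x + (x (σ m) + x (σ.symm m)) := by
  have h : ∀ i, (x + Pi.single m 1 : κ → ZMod 2) i * (x + Pi.single m 1 : κ → ZMod 2) (σ i) =
      x i * x (σ i) + ((if i = m then x (σ i) else 0) + (if i = σ.symm m then x i else 0)) := by
    intro i
    by_cases h1 : i = m
    · subst h1
      have h2 : i ≠ σ.symm i := fun h => hm (by simpa using congrArg σ h)
      simp [hm, h2]
      ring
    · by_cases h2 : i = σ.symm m
      · subst h2
        simp [h1]
        ring
      · have h3 : σ i ≠ m := fun h => h2 (by simp [← h])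
        simp [h1, h2, h3]
  simp only [cycleForm, h, Finset.sum_add_distrib, Finset.sum_ite_eq', Finset.mem_univ, if_true]

end Ring

theorem finRotate_iterate_ne {N k : ℕ} (hk : 0 < k) (hkN : k < N) (i : Fin N) :
    (finRotate N)^[k] i ≠ i := by
  obtain ⟨n, rfl⟩ : ∃ n, N = n + 1 := ⟨N - 1, by omega⟩
  have h : ∀ l, (((finRotate (n + 1))^[l] i : Fin (n + 1)) : ℕ) = (i + l) % (n + 1) := by
    intro l
    induction l with
    | zero => simp [Nat.mod_eq_of_lt i.2]
    | succ l ih =>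
      rw [Function.iterate_succ_apply', finRotate_apply, Fin.val_add, ih, Fin.val_one',
        ← Nat.add_mod, add_assoc]
  intro hi
  have hi' := h k
  rw [hi] at hi'
  by_cases hlt : (i : ℕ) + k < n + 1
  · rw [Nat.mod_eq_of_lt hlt] at hi'
    omega
  · rw [Nat.mod_eq_sub_mod (by omega), Nat.mod_eq_of_lt (by omega)] at hi'
    omega

/-- Let `C` be a ternary linear code of strength two. The signed superposition over `y ∈ C` of
`|y⟩` with the ring graph state displaced by the sign pattern `k y` is 2-uniform, provided that any
two distinct codewords with Hamming distance at most two carry sign patterns with Hamming distance at least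
four. -/
theorem exists_isUniformState_ring {a N : ℕ} (hN : 5 ≤ N) (C : AddSubgroup (Fin a → ZMod 3))
    (k : (Fin a → ZMod 3) → Fin N → ZMod 2)
    (hC : ∀ P : Finset (Fin a), P.card ≤ 2 → ∀ u : Fin a → ZMod 3,
      ∃ c ∈ C, ∀ i ∈ P, c i = u i)
    (hk : ∀ y ∈ C, ∀ y' ∈ C, y ≠ y' → hammingDist y y' ≤ 2 → 4 ≤ hammingDist (k y) (k y')) :
    ∃ ψ : TensorSpace (qutritsQubits a N), IsUniformState 2 ψ := by
  classical
  let σ : Equiv.Perm (Fin N) := finRotate N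
  have h1 : ∀ i, σ i ≠ i := finRotate_iterate_ne (k := 1) (by omega) (by omega)
  have h2 : ∀ i, σ (σ i) ≠ i := finRotate_iterate_ne (k := 2) (by omega) (by omega)
  have h3 : ∀ i, σ (σ (σ i)) ≠ i := finRotate_iterate_ne (k := 3) (by omega) (by omega)
  have h4 : ∀ i, σ (σ (σ (σ i))) ≠ i := finRotate_iterate_ne (k := 4) (by omega) (by omega)
  let phase : (Fin a → ZMod 3) → (Fin N → ZMod 2) → ZMod 2 := fun y x =>
    cycleForm σ x + k y ⬝ᵥ x
  have hphase : ∀ y x m, phase y (x + Pi.single m 1) =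
      phase y x + (x (σ m) + x (σ.symm m) + k y m) := by
    intro y x m
    simp only [phase, cycleForm_add_single (h1 m), dotProduct_add, dotProduct_single_one]
    ring
  let φ : (Fin a → ZMod 3) × (Fin N → ZMod 2) → ℤ := fun w =>
    if w.1 ∈ C then bitSign (phase w.1 w.2) else 0
  refine exists_isUniformState_two_of_perm φ ⟨0, ?_⟩ ?_ ?_
  · have : bitSign (phase 0 0) ≠ 0 := fun h => by simpa [h] using bitSign_sq (phase 0 0)
    simpa [φ] using this
  · intro P Q hPQ u
    obtain ⟨c, hc, hcu⟩ := hC P (by omega) u.1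
    refine ⟨Equiv.addRight (c, u.2), fun w => ⟨?_, fun i hi => ?_, fun j _ => rfl⟩⟩
    · simp only [φ, Equiv.coe_addRight, Prod.fst_add, C.add_mem_cancel_right hc]
      split_ifs <;> simp [bitSign_sq]
    · simp [hcu i hi]
  · intro P Q hPQ δ hδP hδQ hδ
    -- It is enough to flip, for each `y` separately, one qubit outside `Q`.
    suffices h : ∀ y ∈ C, y + δ.1 ∈ C →
        ∃ m ∉ Q, δ.2 (σ m) + δ.2 (σ.symm m) + (k y m + k (y + δ.1) m) = 1 by
      have h' : ∀ y, ∃ e : Fin N → ZMod 2, (∀ j ∈ Q, e j = 0) ∧ ∀ x,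
          φ (y, x + e) * φ ((y, x + e) + δ) = -(φ (y, x) * φ ((y, x) + δ)) := by
        intro y
        by_cases hy : y ∈ C ∧ y + δ.1 ∈ C
        · obtain ⟨m, hmQ, hm⟩ := h y hy.1 hy.2
          refine ⟨Pi.single m 1, fun j hj => ?_, fun x => ?_⟩
          · exact Pi.single_eq_of_ne (fun h' : j = m => hmQ (h' ▸ hj)) _
          · simp only [φ, Prod.fst_add, Prod.snd_add, hy.1, hy.2, if_true,
              add_right_comm x _ δ.2, hphase, ← bitSign_add, Pi.add_apply]
            have h2 : ∀ b : ZMod 2, b + b = 0 := by decide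
            have hflip : ∀ b : ZMod 2, bitSign (b + 1) = -bitSign b := by decide
            rw [← hflip, ← hm]
            congr 1
            linear_combination h2 (x (σ m)) + h2 (x (σ.symm m))
        · refine ⟨0, fun _ _ => rfl, fun x => ?_⟩
          have : φ (y, x) * φ ((y, x) + δ) = 0 := by
            simp only [φ, Prod.fst_add]
            split_ifs <;> simp_all
          simp [this]
      choose e heQ he using h'
      refine ⟨Equiv.prodShear (Equiv.refl _) fun y => Equiv.addRight (e y), fun w => ⟨?_, ?_, ?_⟩⟩
      · intro i _
        rfl
      · intro j hj
        simp [heQ w.1 j hj]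
      · exact he w.1 w.2
    intro y hy hy'
    by_cases hδ1 : δ.1 = 0
    · have hδ2 : δ.2 ≠ 0 := fun h => hδ (Prod.ext hδ1 h)
      obtain ⟨m, hmQ, hm⟩ := exists_neighbor_sum_eq_one h1 h2 h3 h4 (by omega) hδQ hδ2
      refine ⟨m, hmQ, ?_⟩
      have : ∀ b : ZMod 2, b + b = 0 := by decide
      rw [hδ1, add_zero, hm, this, add_zero]
    · have hP : P.Nonempty := by
        obtain ⟨i, hi⟩ := Function.ne_iff.1 hδ1
        exact ⟨i, by_contra fun h => hi (hδP i h)⟩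
      have hdist : hammingDist y (y + δ.1) ≤ 2 := by
        have hsub : (Finset.univ.filter fun i => y i ≠ (y + δ.1) i) ⊆ P := by
          intro i hi
          by_contra h
          simp [hδP i h] at hi
        exact (Finset.card_le_card hsub).trans (by omega)
      have h4' := hk y hy _ hy' (fun h => hδ1 (by simpa using h.symm)) hdist
      -- The at most one qubit in `Q` and its two neighbours do not exhaust the four or more
      -- places at which the sign patterns differ.
      let B : Finset (Fin N) := Q ∪ (Q.image σ ∪ Q.image σ.symm)
      have hB : B.card ≤ 3 := by
        change (Q ∪ (Q.image σ ∪ Q.image σ.symm)).card ≤ 3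
        have hP1 := hP.card_pos
        have e1 := Finset.card_union_le Q (Q.image σ ∪ Q.image σ.symm)
        have e2 := Finset.card_union_le (Q.image σ) (Q.image σ.symm)
        have e3 := Finset.card_image_le (s := Q) (f := σ)
        have e4 := Finset.card_image_le (s := Q) (f := σ.symm)
        omega
      obtain ⟨m, hm, hmB⟩ : ∃ m ∈ Finset.univ.filter (fun m => k y m ≠ k (y + δ.1) m), m ∉ B :=
        Finset.exists_mem_notMem_of_card_lt_card (lt_of_le_of_lt hB h4')
      simp only [Finset.mem_filter, Finset.mem_univ, true_and] at hm
      simp only [B, Finset.mem_union, Finset.mem_image, not_or, not_exists, not_and] at hmB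
      refine ⟨m, hmB.1, ?_⟩
      rw [hδQ (σ m) fun h => hmB.2.2 _ h (by simp), hδQ (σ.symm m) fun h => hmB.2.1 _ h (by simp)]
      have : ∀ b c : ZMod 2, b ≠ c → 0 + 0 + (b + c) = 1 := by decide
      exact this _ _ hm

/-! ### Codes for the qutrits and sign patterns for the qubits -/

/-- Nine of the codewords of the extended binary Hamming code of length eight, read as the affine
functions on `(ZMod 2)^3` evaluated at the binary digits of `m < 8`, and padded with zeros. -/
def hammingWord (p q : ZMod 3) (m : ℕ) : ZMod 2 :=
  if m < 8 then
    (if p = 1 then 1 else 0) + (if p = 2 then (m : ZMod 2) else 0) +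
      (if q = 1 then ((m / 2 : ℕ) : ZMod 2) else 0) + (if q = 2 then ((m / 4 : ℕ) : ZMod 2) else 0)
  else 0

theorem four_le_hammingDist_hammingWord {N : ℕ} (hN : 8 ≤ N) {p q p' q' : ZMod 3}
    (h : p ≠ p' ∨ q ≠ q') :
    4 ≤ hammingDist (fun m : Fin N => hammingWord p q m) (fun m : Fin N => hammingWord p' q' m) := by
  have h8 : ∀ p q p' q' : ZMod 3, p ≠ p' ∨ q ≠ q' →
      4 ≤ (Finset.univ.filter fun m : Fin 8 => hammingWord p q m ≠ hammingWord p' q' m).card := by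
    decide +kernel
  refine (h8 p q p' q' h).trans ?_
  rw [← Finset.card_map (Fin.castLEEmb hN)]
  refine Finset.card_le_card fun m hm => ?_
  obtain ⟨l, hl, rfl⟩ := Finset.mem_map.1 hm
  simpa using hl

/-- The ternary tetracode, a `[4, 2, 3]` code: two free coordinates followed by two parity
checks. -/
def tetracode : AddSubgroup (Fin 4 → ZMod 3) where
  carrier := {y | y 2 = y 0 + y 1 ∧ y 3 = y 0 + 2 * y 1}
  zero_mem' := by simp
  add_mem' := by
    rintro y y' ⟨h1, h2⟩ ⟨h1', h2'⟩
    refine ⟨?_, ?_⟩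
    · simp only [Pi.add_apply, h1, h1']
      ring
    · simp only [Pi.add_apply, h2, h2']
      ring
  neg_mem' := by
    rintro y ⟨h1, h2⟩
    refine ⟨?_, ?_⟩
    · simp only [Pi.neg_apply, h1]
      ring
    · simp only [Pi.neg_apply, h2]
      ring

theorem mem_tetracode {y : Fin 4 → ZMod 3} :
    y ∈ tetracode ↔ y 2 = y 0 + y 1 ∧ y 3 = y 0 + 2 * y 1 := Iff.rfl

theorem exists_subset_pair {a : ℕ} (ha : 2 ≤ a) {P : Finset (Fin a)} (hP : P.card ≤ 2) :
    ∃ i j, i ≠ j ∧ P ⊆ {i, j} := by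
  obtain ⟨P', hPP', -, hP'⟩ := Finset.exists_subsuperset_card_eq (Finset.subset_univ P) hP
    (by simpa using ha)
  obtain ⟨i, j, hij, rfl⟩ := Finset.card_eq_two.1 hP'
  exact ⟨i, j, hij, hPP'⟩

theorem exists_mem_tetracode {P : Finset (Fin 4)} (hP : P.card ≤ 2) (u : Fin 4 → ZMod 3) :
    ∃ c ∈ tetracode, ∀ i ∈ P, c i = u i := by
  obtain ⟨i, j, hij, hPij⟩ := exists_subset_pair (by norm_num) hP
  have h : ∀ i j : Fin 4, i ≠ j → ∀ p q : ZMod 3, ∃ s t : ZMod 3,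
      (![s, t, s + t, s + 2 * t] : Fin 4 → ZMod 3) i = p ∧
      (![s, t, s + t, s + 2 * t] : Fin 4 → ZMod 3) j = q := by
    decide +kernel
  obtain ⟨s, t, hi, hj⟩ := h i j hij (u i) (u j)
  refine ⟨![s, t, s + t, s + 2 * t], mem_tetracode.2 ⟨rfl, rfl⟩, fun l hl => ?_⟩
  rcases Finset.mem_insert.1 (hPij hl) with rfl | hl
  · exact hi
  · rw [Finset.mem_singleton.1 hl]
    exact hj

/-- The tetracode has minimum distance three. -/
theorem eq_zero_of_mem_tetracode {P : Finset (Fin 4)} (hP : P.card ≤ 2) {y : Fin 4 → ZMod 3}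
    (hy : y ∈ tetracode) (h0 : ∀ i ∉ P, y i = 0) : y = 0 := by
  have hPc : 2 ≤ Pᶜ.card := by
    rw [Finset.card_compl, Fintype.card_fin]
    omega
  obtain ⟨i, j, hi, hj, hij⟩ := Finset.one_lt_card_iff.1 hPc
  have h : ∀ i j : Fin 4, i ≠ j → ∀ s t : ZMod 3,
      (![s, t, s + t, s + 2 * t] : Fin 4 → ZMod 3) i = 0 →
      (![s, t, s + t, s + 2 * t] : Fin 4 → ZMod 3) j = 0 → s = 0 ∧ t = 0 := by
    decide +kernel
  have hy' : y = ![y 0, y 1, y 0 + y 1, y 0 + 2 * y 1] := by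
    funext l
    fin_cases l
    exacts [rfl, rfl, hy.1, hy.2]
  obtain ⟨hs, ht⟩ := h i j hij (y 0) (y 1) (hy' ▸ h0 i (Finset.mem_compl.1 hi))
    (hy' ▸ h0 j (Finset.mem_compl.1 hj))
  rw [hy', hs, ht]
  funext l
  fin_cases l <;> simp

/-- The tetracode punctured in its last coordinate, a `[3, 2, 2]` code. -/
def puncturedTetracode : AddSubgroup (Fin 3 → ZMod 3) where
  carrier := {y | y 2 = y 0 + y 1}
  zero_mem' := by simp
  add_mem' := by
    intro y y' (h : _ = _) (h' : _ = _)
    show _ = _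
    simp only [Pi.add_apply, h, h']
    ring
  neg_mem' := by
    intro y (h : _ = _)
    show _ = _
    simp only [Pi.neg_apply, h]
    ring

theorem exists_isUniformState_one {N : ℕ} (hN : 8 ≤ N) :
    ∃ ψ : TensorSpace (qutritsQubits 1 N), IsUniformState 2 ψ := by
  refine exists_isUniformState_ring (by omega) ⊤ (fun y m => hammingWord (y 0) 0 m)
    (fun P _ u => ⟨u, trivial, fun _ _ => rfl⟩) fun y _ y' _ hne _ => ?_
  refine four_le_hammingDist_hammingWord hN (.inl fun h => hne ?_)
  funext i
  rw [Subsingleton.elim i 0, h]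

theorem exists_isUniformState_two {N : ℕ} (hN : 8 ≤ N) :
    ∃ ψ : TensorSpace (qutritsQubits 2 N), IsUniformState 2 ψ := by
  refine exists_isUniformState_ring (by omega) ⊤ (fun y m => hammingWord (y 0) (y 1) m)
    (fun P _ u => ⟨u, trivial, fun _ _ => rfl⟩) fun y _ y' _ hne _ => ?_
  refine four_le_hammingDist_hammingWord hN ?_
  by_contra! h
  refine hne (funext fun i => ?_)
  fin_cases i
  exacts [h.1, h.2]

theorem exists_isUniformState_three {N : ℕ} (hN : 8 ≤ N) :
    ∃ ψ : TensorSpace (qutritsQubits 3 N), IsUniformState 2 ψ := by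
  refine exists_isUniformState_ring (by omega) puncturedTetracode
    (fun y m => hammingWord (y 0) (y 1) m) (fun P hP u => ?_) fun y hy y' hy' hne _ => ?_
  · obtain ⟨c, hc, hcu⟩ := exists_mem_tetracode (P := P.map Fin.castSuccEmb)
      (by simpa using hP) (Fin.snoc u 0)
    refine ⟨fun i => c i.castSucc, hc.1, fun i hi => ?_⟩
    simpa using hcu i.castSucc (Finset.mem_map.2 ⟨i, hi, rfl⟩)
  · refine four_le_hammingDist_hammingWord hN ?_
    by_contra! h
    refine hne (funext fun i => ?_)
    have h2 : y 2 = y' 2 := by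
      rw [show y 2 = _ from hy, show y' 2 = _ from hy', h.1, h.2]
    fin_cases i
    exacts [h.1, h.2, h2]

/-- The product of the absolutely maximally entangled state of four qutrits, which is supported on
the tetracode, with a ring graph state. -/
theorem exists_isUniformState_four_of_five_le {N : ℕ} (hN : 5 ≤ N) :
    ∃ ψ : TensorSpace (qutritsQubits 4 N), IsUniformState 2 ψ := by
  refine exists_isUniformState_ring hN tetracode (fun _ _ => 0)
    (fun P hP u => exists_mem_tetracode hP u) fun y hy y' hy' hne hdist => ?_
  refine absurd (sub_eq_zero.1 ?_) hne
  refine eq_zero_of_mem_tetracode hdist (tetracode.sub_mem hy hy') fun i hi => ?_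
  simpa [sub_eq_zero] using hi

/-! ### Four qutrits and four qubits -/

/-- The injection of `ZMod 2` into `ZMod 3` that sends `0` to `0` and `1` to `1`. -/
def bitToTrit (b : ZMod 2) : ZMod 3 := if b = 0 then 0 else 1

theorem bitToTrit_injective : Function.Injective bitToTrit := by
  unfold Function.Injective
  decide

/-- A representative of the coset of the tetracode attached to the bit string `x`. For `x` of even
weight, the coset determines `x` up to complementation. -/
def cosetShift (x : Fin 4 → ZMod 2) : Fin 4 → ZMod 3 :=
  ![0, 0, bitToTrit (x 0 + x 1), bitToTrit (x 0 + x 2)]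

theorem cosetShift_add_const (x : Fin 4 → ZMod 2) (b : ZMod 2) :
    cosetShift (x + fun _ => b) = cosetShift x := by
  have h : ∀ c d : ZMod 2, c + b + (d + b) = c + d := by
    revert b
    decide
  simp [cosetShift, h]

/-- Bit strings of even weight in the same coset are equal or complementary. -/
theorem eq_const_of_cosetShift_sub_mem {x ε : Fin 4 → ZMod 2} (hε : ∑ j, ε j = 0)
    (h : cosetShift (x + ε) - cosetShift x ∈ tetracode) : ∀ i j, ε i = ε j := by
  obtain ⟨h1, h2⟩ := h
  simp only [cosetShift, Pi.sub_apply, Matrix.cons_val, Pi.add_apply, sub_self, mul_zero,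
    add_zero, sub_eq_zero] at h1 h2
  replace h1 := bitToTrit_injective h1
  replace h2 := bitToTrit_injective h2
  have e1 : ε 0 + ε 1 = 0 := by linear_combination h1
  have e2 : ε 0 + ε 2 = 0 := by linear_combination h2
  rw [Fin.sum_univ_four] at hε
  have key : ∀ a b c d : ZMod 2, a + b = 0 → a + c = 0 → a + b + c + d = 0 →
      b = a ∧ c = a ∧ d = a := by decide
  obtain ⟨k1, k2, k3⟩ := key _ _ _ _ e1 e2 hε
  have k : ∀ i, ε i = ε 0 := by
    intro i
    fin_cases i
    exacts [rfl, k1, k2, k3]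
  intro i j
  rw [k i, k j]

/-- The equal superposition of the 72 labels `(y, x)` with `x` of even weight and `y` in the coset
of the tetracode attached to `x`. These labels form an orthogonal array of strength two and differ
pairwise in at least three places. -/
theorem exists_isUniformState_four_four :
    ∃ ψ : TensorSpace (qutritsQubits 4 4), IsUniformState 2 ψ := by
  classical
  let R : (Fin 4 → ZMod 3) × (Fin 4 → ZMod 2) → Prop := fun w =>
    ∑ j, w.2 j = 0 ∧ w.1 - cosetShift w.2 ∈ tetracode
  refine exists_isUniformState_two_of_perm (fun w => if R w then 1 else 0) ⟨0, ?_⟩ ?_ ?_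
  · have : cosetShift 0 = 0 := by decide
    simp [R, this, tetracode.zero_mem]
  · intro P Q hPQ u
    -- If `P` is nonempty, `v` is constant and leaves the coset unchanged.
    obtain ⟨v, c, hv, hc, hvQ, hcP⟩ : ∃ (v : Fin 4 → ZMod 2) (c : Fin 4 → ZMod 3),
        ∑ j, v j = 0 ∧ c ∈ tetracode ∧ (∀ j ∈ Q, v j = u.2 j) ∧
        ∀ x, ∀ i ∈ P, c i + (cosetShift (x + v) - cosetShift x) i = u.1 i := by
      rcases P.eq_empty_or_nonempty with rfl | hP
      · obtain ⟨m, hm⟩ : ∃ m, m ∉ Q := by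
          by_contra! h
          rw [Finset.eq_univ_iff_forall.2 h] at hPQ
          simp at hPQ
        refine ⟨u.2 + Pi.single m (∑ j, u.2 j), 0, ?_, tetracode.zero_mem, fun j hj => ?_, by simp⟩
        · have h2 : ∀ b : ZMod 2, b + b = 0 := by decide
          simp only [Pi.add_apply, Finset.sum_add_distrib, Finset.sum_pi_single', Finset.mem_univ,
            if_true, h2]
        · have : j ≠ m := fun h => hm (h ▸ hj)
          simp [this]
      · have hQ : Q.card ≤ 1 := by
          have := hP.card_pos
          omega
        obtain ⟨m, hm⟩ := Finset.card_le_one_iff_subset_singleton.1 hQ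
        obtain ⟨c, hc, hcu⟩ := exists_mem_tetracode (show P.card ≤ 2 by omega) u.1
        refine ⟨fun _ => u.2 m, c, ?_, hc, fun j hj => ?_, fun x i hi => ?_⟩
        · have h4 : ∀ b : ZMod 2, b + b + b + b = 0 := by decide
          rw [Fin.sum_univ_four]
          exact h4 _
        · rw [Finset.mem_singleton.1 (hm hj)]
        · rw [cosetShift_add_const, sub_self, Pi.zero_apply, add_zero, hcu i hi]
    let τ : Equiv.Perm ((Fin 4 → ZMod 2) × (Fin 4 → ZMod 3)) :=
      Equiv.prodShear (Equiv.addRight v) fun x =>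
        Equiv.addRight (c + (cosetShift (x + v) - cosetShift x))
    refine ⟨((Equiv.prodComm _ _).trans τ).trans (Equiv.prodComm _ _),
      fun w => ⟨?_, fun i hi => ?_, fun j hj => ?_⟩⟩
    · have hR : R (w.1 + (c + (cosetShift (w.2 + v) - cosetShift w.2)), w.2 + v) ↔ R w := by
        have e : w.1 + (c + (cosetShift (w.2 + v) - cosetShift w.2)) - cosetShift (w.2 + v) =
            (w.1 - cosetShift w.2) + c := by abel
        simp only [R, e, tetracode.add_mem_cancel_right hc, Pi.add_apply,
          Finset.sum_add_distrib, hv, add_zero]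
      exact congrArg (· ^ 2) (if_congr hR rfl rfl)
    · simp only [τ, Equiv.trans_apply, Equiv.prodComm_apply, Prod.fst_swap, Equiv.prodShear_apply,
        Prod.snd_swap, Equiv.coe_addRight, Pi.add_apply]
      rw [hcP _ i hi]
    · simp [τ, hvQ j hj]
  · intro P Q hPQ δ hδP hδQ hδ
    refine ⟨Equiv.refl _, fun w => ⟨fun _ _ => rfl, fun _ _ => rfl, ?_⟩⟩
    suffices h : ¬ (R w ∧ R (w + δ)) by
      simp only [Equiv.refl_apply]
      split_ifs <;> simp_all
    rintro ⟨⟨hw2, hw1⟩, hw2', hw1'⟩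
    simp only [Prod.fst_add, Prod.snd_add, Pi.add_apply, Finset.sum_add_distrib, hw2, zero_add]
      at hw1' hw2'
    have hmem : δ.1 - (cosetShift (w.2 + δ.2) - cosetShift w.2) ∈ tetracode := by
      have := tetracode.sub_mem hw1' hw1
      rwa [show w.1 + δ.1 - cosetShift (w.2 + δ.2) - (w.1 - cosetShift w.2) =
        δ.1 - (cosetShift (w.2 + δ.2) - cosetShift w.2) by abel] at this
    -- Either `P` is empty, or `Q` has at most one element and `δ.2` vanishes by parity.
    have hδ2 : δ.2 = 0 := by
      rcases P.eq_empty_or_nonempty with rfl | hP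
      · have hδ1 : δ.1 = 0 := funext fun i => hδP i (by simp)
        rw [hδ1, zero_sub] at hmem
        have hconst := eq_const_of_cosetShift_sub_mem hw2' (neg_mem_iff.1 hmem)
        obtain ⟨m, hm⟩ : ∃ m, m ∉ Q := by
          by_contra! h
          rw [Finset.eq_univ_iff_forall.2 h] at hPQ
          simp at hPQ
        exact funext fun i => (hconst i m).trans (hδQ m hm)
      · have hQ : Q.card ≤ 1 := by
          have := hP.card_pos
          omega
        obtain ⟨m, hm⟩ := Finset.card_le_one_iff_subset_singleton.1 hQ
        have h0 : ∀ j ≠ m, δ.2 j = 0 := fun j hj =>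
          hδQ j fun h => hj (Finset.mem_singleton.1 (hm h))
        rw [Finset.sum_eq_single m (fun j _ hj => h0 j hj) (by simp)] at hw2'
        funext j
        by_cases hj : j = m
        · rw [hj, hw2', Pi.zero_apply]
        · exact h0 j hj
    rw [hδ2, add_zero, sub_self, sub_zero] at hmem
    exact hδ (Prod.ext (eq_zero_of_mem_tetracode (by omega) hmem hδP) hδ2)

end QuantumUniform

theorem proposition2 :
    (∀ N : ℕ, 8 ≤ N →
      ∃ ψ : QuantumUniform.TensorSpace (QuantumUniform.qutritsQubits 1 N),
        QuantumUniform.IsUniformState 2 ψ) ∧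
    (∀ N : ℕ, 12 ≤ N →
      ∃ ψ : QuantumUniform.TensorSpace (QuantumUniform.qutritsQubits 2 N),
        QuantumUniform.IsUniformState 2 ψ) ∧
    (∀ N : ℕ, (N = 8 ∨ 10 ≤ N) →
      ∃ ψ : QuantumUniform.TensorSpace (QuantumUniform.qutritsQubits 3 N),
        QuantumUniform.IsUniformState 2 ψ) ∧
    (∀ N : ℕ, 4 ≤ N →
      ∃ ψ : QuantumUniform.TensorSpace (QuantumUniform.qutritsQubits 4 N),
        QuantumUniform.IsUniformState 2 ψ) := by
  refine ⟨fun N hN => QuantumUniform.exists_isUniformState_one hN,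
    fun N hN => QuantumUniform.exists_isUniformState_two (by omega),
    fun N hN => QuantumUniform.exists_isUniformState_three (by omega), fun N hN => ?_⟩
  rcases hN.eq_or_lt with rfl | hN
  · exact QuantumUniform.exists_isUniformState_four_four
  · exact QuantumUniform.exists_isUniformState_four_of_five_le hN
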